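/- Let $G$ be a finite group and $p$ a prime number. Notation. A finite category $\mathcal C$ is said to have Euler characteristic if there are rational functions $k^\bullet$ (a weighting) and $k_\bullet$ (a coweighting) on its objects with $\sum_b |\mathcal C(a,b)|\,k^b = 1$ for all objects $a$ and $\sum_a k_a\,|\mathcal C(a,b)| = 1$ for all objects $b$; its Euler characteristic is then $\chi(\mathcal C)=\sum_b k^b=\sum_a k_a$, which does not depend on the choices. Every finite poset, regarded as a category, has Euler characteristic (and $\chi(\emptyset)=0$). For a finite group $Q$ let $\mathcal S_Q^*$ be the poset of all nonidentity $p$-subgroups of $Q$, ordered by inclusion. Let $\mu(H)=\mu(1,H)$, where $\mu$ is the Möbius function of the poset of all subgroups of $G$. For a nonidentity $p$-subgroup $H$ of $G$ and $x\in C_G(H)$, the group $H$ is a normal subgroup of $C_{N_G(H)}(x)$, the centralizer of $x$ in $N_G(H)$. Let $C_G/\langle x\rangle$ be the subposet of $\mathcal S^*_{N_G(H)/H}$ of all nonidentity $p$-subgroups $K/H$ of $N_G(H)/H$, where $H\le K\le N_G(H)$, with $x\in C_G(K)$. Then $$\sum_{H}\big(1-\chi(\mathcal S^*_{N_G(H)/H})+\mu(H)\big)=0,$$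 $$\sum_{H}\ \sum_{x\in C_G(H)}\big(1-\chi(\mathcal S^*_{C_{N_G(H)}(x)/H})+\mu(H)\big)=0,\qquad\text{equivalently}\qquad \sum_{H}\ \sum_{x\in C_G(H)}\big(1-\chi(C_G/\langle x\rangle)+\mu(H)\big)=0,$$ $$\sum_{H}\big(|H|-\chi(\mathcal S^*_{N_G(H)/H})\,|H|+\mu(H)\big)=\frac{p-1}{p}\sum_{C}|C|,$$ where $H$ runs over the set of nonidentity $p$-subgroups of $G$ and $C$ over the set of nonidentity cyclic $p$-subgroups of $G$. -/

import Mathlib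

open CategoryTheory
open scoped Classical

/-! ### Euler characteristics of square matrices and finite categories (Leinster) -/

/-- A weighting for the rational square matrix `ζ`: a column vector `k` with
`∑ b, ζ a b * k b = 1` for all `a`. -/
def IsWeighting {S : Type*} [Fintype S] (ζ : Matrix S S ℚ) (k : S → ℚ) : Prop :=
  ∀ a, ∑ b, ζ a b * k b = 1

/-- A coweighting for the rational square matrix `ζ`: a row vector `k` with
`∑ a, k a * ζ a b = 1` for all `b`. -/
def IsCoweighting {S : Type*} [Fintype S] (ζ : Matrix S S ℚ) (k : S → ℚ) : Prop :=
  ∀ b, ∑ a, k a * ζ a b = 1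

/-- The matrix `ζ` has Euler characteristic if it admits a weighting and a coweighting. -/
def HasEulerChar {S : Type*} [Fintype S] (ζ : Matrix S S ℚ) : Prop :=
  (∃ k, IsWeighting ζ k) ∧ (∃ k, IsCoweighting ζ k)

/-- The Euler characteristic of a matrix: the sum of the values of any weighting
(with the junk value `0` if `ζ` does not have Euler characteristic). -/
noncomputable def matrixEulerChar {S : Type*} [Fintype S] (ζ : Matrix S S ℚ) : ℚ :=
  if h : HasEulerChar ζ then ∑ b, h.1.choose b else 0

/-- The sum of the values of a weighting equals the sum of the values of a coweighting. -/
theorem IsWeighting.sum_eq {S : Type*} [Fintype S] {ζ : Matrix S S ℚ} {k l : S → ℚ}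
    (hk : IsWeighting ζ k) (hl : IsCoweighting ζ l) : ∑ b, k b = ∑ a, l a := by
  calc ∑ b, k b = ∑ b, (∑ a, l a * ζ a b) * k b :=
        Finset.sum_congr rfl fun b _ => by rw [hl b, one_mul]
    _ = ∑ a, l a * ∑ b, ζ a b * k b := by
        simp only [Finset.sum_mul, Finset.mul_sum, mul_assoc]
        exact Finset.sum_comm
    _ = ∑ a, l a := Finset.sum_congr rfl fun a _ => by rw [hk a, mul_one]

/-- The Euler characteristic does not depend on the choice of the weighting or coweighting. -/
theorem matrixEulerChar_eq {S : Type*} [Fintype S] {ζ : Matrix S S ℚ} {k l : S → ℚ}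
    (hk : IsWeighting ζ k) (hl : IsCoweighting ζ l) :
    matrixEulerChar ζ = ∑ b, k b ∧ matrixEulerChar ζ = ∑ a, l a := by
  have h : HasEulerChar ζ := ⟨⟨k, hk⟩, ⟨l, hl⟩⟩
  have h1 : matrixEulerChar ζ = ∑ a, l a := by
    rw [matrixEulerChar, dif_pos h]
    exact h.1.choose_spec.sum_eq hl
  exact ⟨h1.trans (hk.sum_eq hl).symm, h1⟩

/-- The `ζ`-matrix of a finite category counts the morphisms between pairs of objects. -/
def zetaMatrix (C : Type*) [SmallCategory C] [FinCategory C] : Matrix C C ℚ :=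
  fun a b => (Fintype.card (a ⟶ b) : ℚ)

/-- The Euler characteristic `χ(C)` of a finite category. -/
noncomputable def eulerChar (C : Type*) [SmallCategory C] [FinCategory C] : ℚ :=
  matrixEulerChar (zetaMatrix C)

/-- The Euler characteristic `χ(S)` of a finite poset, regarded as a finite category. -/
noncomputable def posetEulerChar (S : Type*) [PartialOrder S] [Finite S] : ℚ :=
  letI : Fintype S := Fintype.ofFinite S
  eulerChar S

/-- In the category of a finite poset, `ζ` is the usual zeta function. -/
theorem zetaMatrix_poset (S : Type*) [PartialOrder S] [Fintype S] (a b : S) :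
    zetaMatrix S a b = if a ≤ b then 1 else 0 := by
  unfold zetaMatrix
  split_ifs with h
  · have : Unique (a ⟶ b) := ⟨⟨homOfLE h⟩, fun _ => Subsingleton.elim _ _⟩
    simp [Fintype.card_unique]
  · have : IsEmpty (a ⟶ b) := ⟨fun f => h (leOfHom f)⟩
    simp

/-- Every finite poset has Euler characteristic. -/
theorem hasEulerChar_poset (S : Type*) [PartialOrder S] [Fintype S] :
    HasEulerChar (zetaMatrix S) := by
  let _ : LocallyFiniteOrder S := Fintype.toLocallyFiniteOrder
  have e1 : ∀ a c : S, ∑ b, zetaMatrix S a b * IncidenceAlgebra.mu ℚ b c =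
      if a = c then 1 else 0 := by
    intro a c
    have h := congrArg (fun f : IncidenceAlgebra ℚ S => f a c)
      (IncidenceAlgebra.zeta_mul_mu (𝕜 := ℚ) (α := S))
    simp only [IncidenceAlgebra.mul_apply, IncidenceAlgebra.one_apply] at h
    rw [← h]
    symm
    refine Finset.sum_subset_zero_on_sdiff (Finset.subset_univ _) ?_ ?_
    · intro b hb
      simp only [Finset.mem_sdiff, Finset.mem_univ, true_and, Finset.mem_Icc, not_and_or] at hb
      rcases hb with hb | hb
      · rw [zetaMatrix_poset, if_neg hb, zero_mul]
      · rw [IncidenceAlgebra.apply_eq_zero_of_not_le hb, mul_zero]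
    · intro b _
      rw [zetaMatrix_poset, IncidenceAlgebra.zeta_apply]
  have e2 : ∀ a c : S, ∑ b, IncidenceAlgebra.mu ℚ a b * zetaMatrix S b c =
      if a = c then 1 else 0 := by
    intro a c
    have h := congrArg (fun f : IncidenceAlgebra ℚ S => f a c)
      (IncidenceAlgebra.mu_mul_zeta (𝕜 := ℚ) (α := S))
    simp only [IncidenceAlgebra.mul_apply, IncidenceAlgebra.one_apply] at h
    rw [← h]
    symm
    refine Finset.sum_subset_zero_on_sdiff (Finset.subset_univ _) ?_ ?_
    · intro b hb
      simp only [Finset.mem_sdiff, Finset.mem_univ, true_and, Finset.mem_Icc, not_and_or] at hb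
      rcases hb with hb | hb
      · rw [IncidenceAlgebra.apply_eq_zero_of_not_le hb, zero_mul]
      · rw [zetaMatrix_poset, if_neg hb, mul_zero]
    · intro b _
      rw [zetaMatrix_poset, IncidenceAlgebra.zeta_apply]
  refine ⟨⟨fun b => ∑ c, IncidenceAlgebra.mu ℚ b c, fun a => ?_⟩,
    ⟨fun b => ∑ c, IncidenceAlgebra.mu ℚ c b, fun a => ?_⟩⟩
  · simp only [Finset.mul_sum]
    rw [Finset.sum_comm]
    simp [e1]
  · simp only [Finset.sum_mul]
    rw [Finset.sum_comm]
    simp [e2]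

/-! ### Posets of `p`-subgroups -/

/-- The poset `S_G^*` of all nonidentity `p`-subgroups of `G`, ordered by inclusion. -/
abbrev NonidentityPSubgroup (p : ℕ) (G : Type*) [Group G] : Type _ :=
  {H : Subgroup G // IsPGroup p H ∧ H ≠ ⊥}

/-- The finite set of all nonidentity `p`-subgroups of `G`. -/
noncomputable def nonidentityPSubgroups (p : ℕ) (G : Type*) [Group G] [Finite G] :
    Finset (Subgroup G) :=
  (Set.toFinite {H : Subgroup G | IsPGroup p H ∧ H ≠ ⊥}).toFinset

/-- The finite set of all nonidentity cyclic `p`-subgroups of `G`. -/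
noncomputable def nonidentityCyclicPSubgroups (p : ℕ) (G : Type*) [Group G] [Finite G] :
    Finset (Subgroup G) :=
  (Set.toFinite {C : Subgroup G | IsPGroup p C ∧ C ≠ ⊥ ∧ IsCyclic C}).toFinset

/-- The Möbius function `μ(K) = μ(1, K)` of the poset of all subgroups of the finite group `G`. -/
noncomputable def subgroupMu {G : Type*} [Group G] [Finite G] (K : Subgroup G) : ℤ :=
  letI : Fintype (Subgroup G) := Fintype.ofFinite _
  letI : LocallyFiniteOrder (Subgroup G) := Fintype.toLocallyFiniteOrder
  IncidenceAlgebra.mu ℤ (⊥ : Subgroup G) K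

/-- The quotient group `N_G(H)/H`, the endomorphism group of `H` in the orbit category. -/
abbrev NormalizerQuotient {G : Type*} [Group G] (H : Subgroup G) : Type _ :=
  Subgroup.normalizer (H : Set G) ⧸ H.subgroupOf (Subgroup.normalizer (H : Set G))

/-- The centralizer `C_{N_G(H)}(x)` of the element `x` in the normalizer of `H`. -/
abbrev normalizerCentralizer {G : Type*} [Group G] (H : Subgroup G) (x : G) : Subgroup G :=
  Subgroup.normalizer (H : Set G) ⊓ Subgroup.centralizer {x}

instance normal_subgroupOf_normalizerCentralizer {G : Type*} [Group G] (H : Subgroup G) (x : G) :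
    (H.subgroupOf (normalizerCentralizer H x)).Normal :=
  Subgroup.normal_subgroupOf_of_le_normalizer inf_le_left

/-- The quotient group `C_{N_G(H)}(x)/H`. It is used for `x ∈ C_G(H)` only; then `H` is a
(normal) subgroup of `C_{N_G(H)}(x)`. -/
abbrev CentralizerQuotient {G : Type*} [Group G] (H : Subgroup G) (x : G) : Type _ :=
  normalizerCentralizer H x ⧸ H.subgroupOf (normalizerCentralizer H x)

/-- The preimage `K ≤ N_G(H)`, as a subgroup of `G`, of a subgroup of `N_G(H)/H`. -/
def quotientPreimage {G : Type*} [Group G] (H : Subgroup G)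
    (Kbar : Subgroup (NormalizerQuotient H)) : Subgroup G :=
  (Kbar.comap (QuotientGroup.mk' (H.subgroupOf (Subgroup.normalizer (H : Set G))))).map
    (Subgroup.normalizer (H : Set G)).subtype

/-- The poset `C_G/⟨x⟩` attached to `H` and `x ∈ C_G(H)`: all nonidentity `p`-subgroups `K/H` of
`N_G(H)/H` with `x ∈ C_G(K)`. -/
abbrev CentralizerPoset (p : ℕ) {G : Type*} [Group G] (H : Subgroup G) (x : G) : Type _ :=
  {Kbar : NonidentityPSubgroup p (NormalizerQuotient H) //
    x ∈ Subgroup.centralizer (quotientPreimage H Kbar.1 : Set G)}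

/-! ### Weightings on finite posets -/

/-! In any finite category a weighting and a coweighting have the same total. Fix a subgroup `C` of
`G` and let `S` be the poset of nonidentity `p`-subgroups of `C`. Its weighting is `H ↦ 1 -
χ(S_{>H})`, and Möbius inversion makes `H ↦ -μ(H)` a coweighting, so `1 - χ(S_{>H}) + μ(H)` sums to
zero. Intersecting with `N_G(H)` is a Galois connection, so `S_{>H}` may be replaced by the `K > H`
inside `N_G(H) ⊓ C`, which are the nonidentity `p`-subgroups of the quotient of `N_G(H) ⊓ C` by `H`
whenever `H ≤ C`.

This gives `sum_intermediatePSubgroup_add_subgroupMu`. Taking `C = ⊤` yields the first identity;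
taking `C = C_G(x)` and summing over `x` yields the second, in both forms. For the last one, the
weighting equation at `⟨x⟩`, summed over nonidentity `p`-elements `x`, evaluates `∑ (1 - χ)(|H| -
1)`; adding the first identity finishes. -/

theorem isWeighting_zetaMatrix_iff {S : Type*} [PartialOrder S] [Fintype S] {k : S → ℚ} :
    IsWeighting (zetaMatrix S) k ↔ ∀ a, ∑ b with a ≤ b, k b = 1 := by
  simp only [IsWeighting, zetaMatrix_poset, ite_mul, one_mul, zero_mul, Finset.sum_filter]

theorem isCoweighting_zetaMatrix_iff {S : Type*} [PartialOrder S] [Fintype S] {k : S → ℚ} :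
    IsCoweighting (zetaMatrix S) k ↔ ∀ b, ∑ a with a ≤ b, k a = 1 := by
  simp only [IsCoweighting, zetaMatrix_poset, mul_ite, mul_one, mul_zero, Finset.sum_filter]

theorem posetEulerChar_eq_sum_weighting {S : Type*} [PartialOrder S] [Fintype S] {k : S → ℚ}
    (hk : IsWeighting (zetaMatrix S) k) : posetEulerChar S = ∑ a, k a := by
  obtain ⟨l, hl⟩ := (hasEulerChar_poset S).2
  rw [← (matrixEulerChar_eq hk hl).1, posetEulerChar, eulerChar]
  congr!

/-- Two finite posets related by a Galois connection have the same Euler characteristic. -/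
theorem GaloisConnection.posetEulerChar_eq {S T : Type*} [PartialOrder S] [PartialOrder T]
    [Finite S] [Finite T] {l : T → S} {u : S → T} (h : GaloisConnection l u) :
    posetEulerChar S = posetEulerChar T := by
  cases nonempty_fintype S
  cases nonempty_fintype T
  obtain ⟨k, hk⟩ := (hasEulerChar_poset S).1
  have hk' := isWeighting_zetaMatrix_iff.1 hk
  -- A weighting pushes forward along the upper adjoint: `a ≤ u s` iff `l a ≤ s`, so the sum above
  -- `a` is the old sum above `l a`.
  have hw : IsWeighting (zetaMatrix T) (fun t => ∑ s with u s = t, k s) := by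
    rw [isWeighting_zetaMatrix_iff]
    intro a
    rw [← hk' (l a), ← Finset.sum_fiberwise_of_maps_to (t := {t : T | a ≤ t}) (g := u)]
    · refine Finset.sum_congr rfl fun t ht => Finset.sum_congr ?_ fun _ _ => rfl
      ext s
      simp only [Finset.mem_filter, Finset.mem_univ, true_and] at ht ⊢
      refine ⟨fun hs => ⟨(h _ _).2 (hs ▸ ht), hs⟩, fun hs => hs.2⟩
    · intro s hs
      simp only [Finset.mem_filter, Finset.mem_univ, true_and] at hs ⊢
      exact (h _ _).1 hs
  rw [posetEulerChar_eq_sum_weighting hk, posetEulerChar_eq_sum_weighting hw]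
  exact (Finset.sum_fiberwise _ _ _).symm

theorem OrderIso.posetEulerChar_eq {S T : Type*} [PartialOrder S] [PartialOrder T]
    [Finite S] [Finite T] (e : S ≃o T) : posetEulerChar S = posetEulerChar T :=
  e.symm.to_galoisConnection.posetEulerChar_eq

/-- The function `a ↦ 1 - χ(S_{> a})` is a weighting on a finite poset `S`. -/
theorem isWeighting_one_sub_posetEulerChar (S : Type*) [PartialOrder S] [Fintype S] :
    IsWeighting (zetaMatrix S) (fun a => 1 - posetEulerChar {b : S // a < b}) := by
  obtain ⟨k, hk⟩ := (hasEulerChar_poset S).1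
  have hk' := isWeighting_zetaMatrix_iff.1 hk
  convert hk using 2 with a
  -- `S_{>a}` is an up-set, so `k` restricts to a weighting on it, and the equation at `a` then
  -- forces `k a = 1 - χ(S_{>a})`.
  have hw : IsWeighting (zetaMatrix {b : S // a < b}) (fun b => k b) := by
    rw [isWeighting_zetaMatrix_iff]
    rintro ⟨c, hc⟩
    rw [← hk' c, Finset.sum_filter]
    refine (Finset.sum_subtype (Finset.univ.filter (a < ·)) (by simp)
      (fun b => if c ≤ b then k b else 0)).symm.trans ?_
    rw [← Finset.sum_filter, Finset.filter_filter]
    refine Finset.sum_congr ?_ fun _ _ => rfl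
    ext b
    simpa using fun h => hc.trans_le h
  rw [posetEulerChar_eq_sum_weighting hw, sub_eq_iff_eq_add, ← hk' a,
    ← Finset.sum_subtype (Finset.univ.filter (a < ·)) (by simp) k]
  have : (Finset.univ.filter (a ≤ ·)) = insert a (Finset.univ.filter (a < ·)) := by
    ext b
    simp [le_iff_eq_or_lt, eq_comm]
  rw [this, Finset.sum_insert (by simp)]

theorem sum_one_sub_posetEulerChar_eq_sum_coweighting {S : Type*} [PartialOrder S] [Fintype S]
    {l : S → ℚ} (hl : IsCoweighting (zetaMatrix S) l) :
    ∑ a, (1 - posetEulerChar {b : S // a < b}) = ∑ a, l a :=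
  (isWeighting_one_sub_posetEulerChar S).sum_eq hl

/-! ### Normalizers and the correspondence theorem for `p`-subgroups above `H`. -/

/-- Normalizers grow in the nilpotent group `K`. -/
theorem IsPGroup.lt_inf_normalizer {G : Type*} [Group G] [Finite G] {p : ℕ} [Fact p.Prime]
    {H K : Subgroup G} (hK : IsPGroup p K) (h : H < K) :
    H < K ⊓ Subgroup.normalizer (H : Set G) := by
  have := hK.isNilpotent
  have h1 : H.subgroupOf K < ⊤ := by
    rw [lt_top_iff_ne_top, Ne, Subgroup.subgroupOf_eq_top]
    exact h.not_ge
  obtain ⟨g, hg, hgH⟩ := SetLike.exists_of_lt (Group.normalizerCondition_of_isNilpotent _ h1)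
  refine lt_of_le_of_ne (le_inf h.le Subgroup.le_normalizer) fun he => hgH ?_
  rw [Subgroup.mem_subgroupOf, he]
  refine ⟨g.2, Subgroup.mem_normalizer_iff.2 fun x => ?_⟩
  have := Subgroup.mem_normalizer_iff.1 hg
  by_cases hx : x ∈ K
  · simpa [Subgroup.mem_subgroupOf] using this ⟨x, hx⟩
  -- Outside `K` both sides fail: conjugation by `g ∈ K` preserves `K`, which contains `H`.
  · refine ⟨fun hxH => absurd (h.le hxH) hx, fun hxH => absurd ?_ hx⟩
    have h2 := K.mul_mem (K.mul_mem (K.inv_mem g.2) (h.le hxH)) g.2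
    simpa [mul_assoc] using h2

/-- The poset of all `p`-subgroups `K` of `G` with `H < K ≤ A`. -/
abbrev IntermediatePSubgroup (p : ℕ) {G : Type*} [Group G] (H A : Subgroup G) : Type _ :=
  {K : Subgroup G // IsPGroup p K ∧ H < K ∧ K ≤ A}

/-- The preimage in `G` of a subgroup of `A ⧸ H`. -/
def Subgroup.preimageOfQuotient {G : Type*} [Group G] (H A : Subgroup G)
    [(H.subgroupOf A).Normal] (L : Subgroup (A ⧸ H.subgroupOf A)) : Subgroup G :=
  (L.comap (QuotientGroup.mk' (H.subgroupOf A))).map A.subtype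

theorem Subgroup.preimageOfQuotient_le_iff {G : Type*} [Group G] {H A : Subgroup G}
    [(H.subgroupOf A).Normal] {L M : Subgroup (A ⧸ H.subgroupOf A)} :
    H.preimageOfQuotient A L ≤ H.preimageOfQuotient A M ↔ L ≤ M := by
  rw [preimageOfQuotient, preimageOfQuotient,
    Subgroup.map_le_map_iff_of_injective A.subtype_injective,
    Subgroup.comap_le_comap_of_surjective (QuotientGroup.mk'_surjective _)]

theorem Subgroup.preimageOfQuotient_le {G : Type*} [Group G] {H A : Subgroup G}
    [(H.subgroupOf A).Normal] (L : Subgroup (A ⧸ H.subgroupOf A)) :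
    H.preimageOfQuotient A L ≤ A :=
  Subgroup.map_subtype_le _

theorem Subgroup.preimageOfQuotient_bot {G : Type*} [Group G] {H A : Subgroup G}
    [(H.subgroupOf A).Normal] (hHA : H ≤ A) : H.preimageOfQuotient A ⊥ = H := by
  rw [preimageOfQuotient, MonoidHom.comap_bot, QuotientGroup.ker_mk',
    Subgroup.subgroupOf_map_subtype, inf_eq_left.2 hHA]

theorem Subgroup.preimageOfQuotient_map {G : Type*} [Group G] {H A K : Subgroup G}
    [(H.subgroupOf A).Normal] (hHK : H ≤ K) (hKA : K ≤ A) :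
    H.preimageOfQuotient A ((K.subgroupOf A).map (QuotientGroup.mk' (H.subgroupOf A))) = K := by
  rw [preimageOfQuotient, Subgroup.comap_map_eq_self, Subgroup.subgroupOf_map_subtype,
    inf_eq_left.2 hKA]
  rw [QuotientGroup.ker_mk']
  exact Subgroup.comap_mono hHK

theorem Subgroup.isPGroup_preimageOfQuotient {G : Type*} [Group G] {p : ℕ} {H A : Subgroup G}
    [(H.subgroupOf A).Normal] (hH : IsPGroup p H) {L : Subgroup (A ⧸ H.subgroupOf A)}
    (hL : IsPGroup p L) : IsPGroup p (H.preimageOfQuotient A L) := by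
  refine (hL.comap_of_ker_isPGroup _ ?_).map _
  rw [QuotientGroup.ker_mk']
  exact hH.comap_subtype

/-- The correspondence theorem for nonidentity `p`-subgroups of `A ⧸ H`. -/
noncomputable def quotientPSubgroupOrderIso {G : Type*} [Group G] {p : ℕ} {H A : Subgroup G}
    [(H.subgroupOf A).Normal] (hH : IsPGroup p H) (hHA : H ≤ A) :
    NonidentityPSubgroup p (A ⧸ H.subgroupOf A) ≃o IntermediatePSubgroup p H A :=
  RelIso.ofSurjective
    (OrderEmbedding.ofMapLEIff
      (fun L => ⟨H.preimageOfQuotient A L.1, Subgroup.isPGroup_preimageOfQuotient hH L.2.1, by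
        have h : ⊥ < L.1 := bot_lt_iff_ne_bot.2 L.2.2
        rw [lt_iff_le_not_ge, ← Subgroup.preimageOfQuotient_le_iff,
          ← Subgroup.preimageOfQuotient_le_iff, Subgroup.preimageOfQuotient_bot hHA] at h
        exact lt_iff_le_not_ge.2 h,
        Subgroup.preimageOfQuotient_le _⟩)
      fun _ _ => Subgroup.preimageOfQuotient_le_iff)
    (by
      rintro ⟨K, hK, hHK, hKA⟩
      have h := Subgroup.preimageOfQuotient_map hHK.le hKA
      refine ⟨⟨_, hK.comap_subtype.map _, fun hb => ?_⟩, Subtype.ext h⟩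
      -- A trivial image would have preimage `H`, yet its preimage is `K > H`.
      erw [hb, Subgroup.preimageOfQuotient_bot hHA] at h
      exact hHK.ne h)

/-- The poset `C_G/⟨x⟩` at `H` is the poset of `p`-subgroups `K > H` of `C_{N_G(H)}(x)`. -/
noncomputable def centralizerPosetOrderIso {G : Type*} [Group G] {p : ℕ} {H : Subgroup G} (x : G)
    (hH : IsPGroup p H) :
    CentralizerPoset p H x ≃o IntermediatePSubgroup p H (normalizerCentralizer H x) :=
  RelIso.ofSurjective
    (OrderEmbedding.ofMapLEIff
      (fun L => ⟨(quotientPSubgroupOrderIso hH Subgroup.le_normalizer L.1).1,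
        (quotientPSubgroupOrderIso hH Subgroup.le_normalizer L.1).2.1,
        (quotientPSubgroupOrderIso hH Subgroup.le_normalizer L.1).2.2.1,
        le_inf (quotientPSubgroupOrderIso hH Subgroup.le_normalizer L.1).2.2.2
          (fun k hk => Subgroup.mem_centralizer_singleton_iff.2
            (Subgroup.mem_centralizer_iff.1 L.2 k hk))⟩)
      fun _ _ => (quotientPSubgroupOrderIso hH Subgroup.le_normalizer).le_iff_le)
    (by
      rintro ⟨K, hK, hHK, hKA⟩
      obtain ⟨L, hL⟩ := (quotientPSubgroupOrderIso hH Subgroup.le_normalizer).surjective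
        ⟨K, hK, hHK, hKA.trans inf_le_left⟩
      have hL' : quotientPreimage H L.1 = K := congrArg Subtype.val hL
      refine ⟨⟨L, ?_⟩, Subtype.ext hL'⟩
      rw [hL', Subgroup.mem_centralizer_iff]
      intro k hk
      exact (Subgroup.mem_centralizer_iff.1 (hKA hk).2 x rfl).symm)

/-- The `p`-subgroups `K > H` of `C` have the same Euler characteristic as those normalizing `H`. -/
theorem posetEulerChar_intermediatePSubgroup_inf_normalizer {G : Type*} [Group G] [Finite G]
    {p : ℕ} [Fact p.Prime] (H C : Subgroup G) :
    posetEulerChar (IntermediatePSubgroup p H C) =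
      posetEulerChar (IntermediatePSubgroup p H (Subgroup.normalizer (H : Set G) ⊓ C)) := by
  have hu (K : IntermediatePSubgroup p H C) : H < K.1 ⊓ Subgroup.normalizer (H : Set G) :=
    K.2.1.lt_inf_normalizer K.2.2.1
  let u (K : IntermediatePSubgroup p H C) :
      IntermediatePSubgroup p H (Subgroup.normalizer (H : Set G) ⊓ C) :=
    ⟨K.1 ⊓ Subgroup.normalizer (H : Set G), K.2.1.to_inf_left, hu K,
      le_inf inf_le_right (inf_le_left.trans K.2.2.2)⟩
  let l (K : IntermediatePSubgroup p H (Subgroup.normalizer (H : Set G) ⊓ C)) :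
      IntermediatePSubgroup p H C := ⟨K.1, K.2.1, K.2.2.1, K.2.2.2.trans inf_le_right⟩
  have h : GaloisConnection l u := fun K L =>
    ⟨fun hKL => show K.1 ≤ L.1 ⊓ _ from le_inf hKL (K.2.2.2.trans inf_le_left),
      fun hKL => show K.1 ≤ L.1 from (show K.1 ≤ L.1 ⊓ _ from hKL).trans inf_le_left⟩
  exact h.posetEulerChar_eq

/-! ### Möbius coweighting and the vanishing sums. -/

/-- The poset of all nonidentity `p`-subgroups of `G` contained in `C`. -/
abbrev NonidentityPSubgroupLE (p : ℕ) {G : Type*} [Group G] (C : Subgroup G) : Type _ :=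
  {H : Subgroup G // IsPGroup p H ∧ H ≠ ⊥ ∧ H ≤ C}

/-- The elements above `H` in the poset of nonidentity `p`-subgroups of `C`. -/
def nonidentityPSubgroupLEGTOrderIso {p : ℕ} {G : Type*} [Group G] {C : Subgroup G}
    (H : NonidentityPSubgroupLE p C) :
    {K : NonidentityPSubgroupLE p C // H < K} ≃o IntermediatePSubgroup p H.1 C where
  toFun K := ⟨K.1.1, K.1.2.1, K.2, K.1.2.2.2⟩
  invFun K := ⟨⟨K.1, K.2.1, ne_bot_of_gt K.2.2.1, K.2.2.2⟩, K.2.2.1⟩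
  left_inv _ := rfl
  right_inv _ := rfl
  map_rel_iff' := Iff.rfl

/-- The function `H ↦ -μ(1, H)` is a coweighting on the nonidentity `p`-subgroups of `C`. -/
theorem isCoweighting_neg_subgroupMu {G : Type*} [Group G] [Finite G] {p : ℕ} (C : Subgroup G)
    [Fintype (NonidentityPSubgroupLE p C)] :
    IsCoweighting (zetaMatrix (NonidentityPSubgroupLE p C)) (fun H => -(subgroupMu H.1 : ℚ)) := by
  rw [isCoweighting_zetaMatrix_iff]
  rintro ⟨H, hH, hb, hC⟩
  let _ : Fintype (Subgroup G) := Fintype.ofFinite _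
  let _ : LocallyFiniteOrder (Subgroup G) := Fintype.toLocallyFiniteOrder
  have h : ∑ K ∈ Finset.Icc ⊥ H, subgroupMu K = if ⊥ = H then 1 else 0 :=
    IncidenceAlgebra.sum_Icc_mu_right (𝕜 := ℤ) (⊥ : Subgroup G) H
  have hs : Finset.Icc ⊥ H = insert ⊥ (Finset.univ.filter fun K => K ≠ ⊥ ∧ K ≤ H) := by
    ext K
    by_cases hK : K = ⊥ <;> simp [hK]
  have hmu : subgroupMu (⊥ : Subgroup G) = 1 := by simp [subgroupMu]
  rw [if_neg hb.symm, hs, Finset.sum_insert (by simp), hmu] at h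
  -- Every nonidentity subgroup of `H` is again a `p`-subgroup of `C`, so the Möbius sum over all
  -- subgroups involves only objects of the poset, apart from the term `μ(1) = 1`.
  have h' : ∑ K : NonidentityPSubgroupLE p C with K ≤ ⟨H, hH, hb, hC⟩, subgroupMu K.1 =
      ∑ K : Subgroup G with K ≠ ⊥ ∧ K ≤ H, subgroupMu K := by
    refine Finset.sum_bij (fun K _ => K.1) ?_ (fun _ _ _ _ => Subtype.ext) ?_ (fun _ _ => rfl)
    · intro K hK
      simp only [Finset.mem_filter, Finset.mem_univ, true_and] at hK ⊢
      exact ⟨K.2.2.1, hK⟩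
    · intro K hK
      simp only [Finset.mem_filter, Finset.mem_univ, true_and] at hK
      exact ⟨⟨K, hH.to_le hK.2, hK.1, hK.2.trans hC⟩, by simpa using hK.2, rfl⟩
  rw [← h', ← eq_neg_iff_add_eq_zero] at h
  rw [Finset.sum_neg_distrib, ← Int.cast_sum, ← Int.cast_neg, ← h, Int.cast_one]

theorem mem_nonidentityPSubgroups {p : ℕ} {G : Type*} [Group G] [Finite G] {H : Subgroup G} :
    H ∈ nonidentityPSubgroups p G ↔ IsPGroup p H ∧ H ≠ ⊥ := by
  simp [nonidentityPSubgroups]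

theorem mem_nonidentityCyclicPSubgroups {p : ℕ} {G : Type*} [Group G] [Finite G]
    {H : Subgroup G} :
    H ∈ nonidentityCyclicPSubgroups p G ↔ IsPGroup p H ∧ H ≠ ⊥ ∧ IsCyclic H := by
  simp [nonidentityCyclicPSubgroups]

theorem sum_intermediatePSubgroup_add_subgroupMu {G : Type*} [Group G] [Finite G] {p : ℕ}
    [Fact p.Prime] (C : Subgroup G) :
    ∑ H ∈ nonidentityPSubgroups p G with H ≤ C,
      (1 - posetEulerChar (IntermediatePSubgroup p H (Subgroup.normalizer (H : Set G) ⊓ C))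
        + (subgroupMu H : ℚ)) = 0 := by
  let _ : Fintype (NonidentityPSubgroupLE p C) := Fintype.ofFinite _
  rw [Finset.sum_subtype (p := fun H : Subgroup G => IsPGroup p H ∧ H ≠ ⊥ ∧ H ≤ C) _
    (by simp [mem_nonidentityPSubgroups, and_assoc]), Finset.sum_add_distrib,
    ← sub_neg_eq_add, sub_eq_zero, ← Finset.sum_neg_distrib,
    ← sum_one_sub_posetEulerChar_eq_sum_coweighting (isCoweighting_neg_subgroupMu C)]
  refine Finset.sum_congr rfl fun H _ => ?_
  rw [(nonidentityPSubgroupLEGTOrderIso H).posetEulerChar_eq,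
    posetEulerChar_intermediatePSubgroup_inf_normalizer H.1 C]

theorem posetEulerChar_normalizerQuotient {G : Type*} [Group G] [Finite G] {p : ℕ}
    {H : Subgroup G} (hH : IsPGroup p H) :
    posetEulerChar (NonidentityPSubgroup p (NormalizerQuotient H)) =
      posetEulerChar
        (IntermediatePSubgroup p H (Subgroup.normalizer (H : Set G) ⊓ ⊤)) := by
  rw [inf_top_eq]
  exact (quotientPSubgroupOrderIso hH Subgroup.le_normalizer).posetEulerChar_eq

theorem sum_one_sub_posetEulerChar_add_subgroupMu {G : Type*} [Group G] [Finite G] {p : ℕ}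
    [Fact p.Prime] :
    ∑ H ∈ nonidentityPSubgroups p G,
      (1 - posetEulerChar (NonidentityPSubgroup p (NormalizerQuotient H)) + (subgroupMu H : ℚ))
        = 0 := by
  rw [← sum_intermediatePSubgroup_add_subgroupMu (p := p) (⊤ : Subgroup G)]
  refine Finset.sum_congr (by simp) fun H hH => ?_
  rw [posetEulerChar_normalizerQuotient (mem_nonidentityPSubgroups.1 (Finset.mem_filter.1 hH).1).1]

/-- The function `H ↦ 1 - χ(S^*_{N_G(H)/H})` is a weighting on the nonidentity `p`-subgroups. -/
theorem sum_one_sub_posetEulerChar_of_le {G : Type*} [Group G] [Finite G] {p : ℕ}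
    [Fact p.Prime] {P : Subgroup G} (hP : IsPGroup p P) (hP' : P ≠ ⊥) :
    ∑ H ∈ nonidentityPSubgroups p G with P ≤ H,
      (1 - posetEulerChar (NonidentityPSubgroup p (NormalizerQuotient H))) = 1 := by
  let _ : Fintype (NonidentityPSubgroupLE p (⊤ : Subgroup G)) := Fintype.ofFinite _
  refine Eq.trans (Eq.symm ?_) (isWeighting_zetaMatrix_iff.1 (isWeighting_one_sub_posetEulerChar
    (NonidentityPSubgroupLE p (⊤ : Subgroup G))) ⟨P, hP, hP', le_top⟩)
  refine Finset.sum_bij (fun K _ => K.1) ?_ (fun _ _ _ _ => Subtype.ext) ?_ ?_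
  · intro K hK
    simp only [Finset.mem_filter, Finset.mem_univ, true_and, mem_nonidentityPSubgroups] at hK ⊢
    exact ⟨⟨K.2.1, K.2.2.1⟩, hK⟩
  · intro K hK
    simp only [Finset.mem_filter, mem_nonidentityPSubgroups] at hK
    exact ⟨⟨K, hK.1.1, hK.1.2, le_top⟩, by simpa using hK.2, rfl⟩
  · intro H _
    rw [(nonidentityPSubgroupLEGTOrderIso H).posetEulerChar_eq,
      posetEulerChar_normalizerQuotient H.2.1,
      posetEulerChar_intermediatePSubgroup_inf_normalizer]

/-- Since `x ∈ C_G(H)` iff `H ≤ C_G(x)`, exchanging the sums leaves, for each `x`, the vanishing sum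
for `C = C_G(x)`. -/
theorem sum_sum_centralizer_add_subgroupMu {G : Type*} [Group G] [Fintype G] {p : ℕ}
    [Fact p.Prime] :
    ∑ H ∈ nonidentityPSubgroups p G, ∑ x : G with x ∈ Subgroup.centralizer (H : Set G),
      (1 - posetEulerChar (IntermediatePSubgroup p H (normalizerCentralizer H x))
        + (subgroupMu H : ℚ)) = 0 := by
  rw [Finset.sum_comm' (t' := Finset.univ)
    (s' := fun x => (nonidentityPSubgroups p G).filter (· ≤ Subgroup.centralizer {x}))]
  · exact Finset.sum_eq_zero fun x _ => sum_intermediatePSubgroup_add_subgroupMu _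
  · intro H x
    simp only [Finset.mem_filter, Finset.mem_univ, true_and, and_true, and_congr_right_iff]
    intro _
    simp only [SetLike.le_def, Subgroup.mem_centralizer_iff, SetLike.mem_coe,
      Set.mem_singleton_iff, forall_eq]
    exact ⟨fun h y hy => (h y hy).symm, fun h y hy => (h hy).symm⟩

/-! ### Counting elements of `p`-power order. -/

/-- The number of nonidentity elements of `p`-power order, counted by the cyclic subgroups they
generate. -/
theorem card_nonidentity_pElements {G : Type*} [Group G] [Fintype G] {p : ℕ} [hp : Fact p.Prime] :
    ((Finset.univ.filter fun x : G => x ≠ 1 ∧ IsPGroup p (Subgroup.zpowers x)).card : ℚ) =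
      ((p : ℚ) - 1) / (p : ℚ) * ∑ C ∈ nonidentityCyclicPSubgroups p G, (Nat.card C : ℚ) := by
  rw [Finset.card_eq_sum_card_fiberwise (f := Subgroup.zpowers)
    (t := nonidentityCyclicPSubgroups p G), Nat.cast_sum, Finset.mul_sum]
  · refine Finset.sum_congr rfl fun C hC => ?_
    obtain ⟨hC, hb, hcyc⟩ := mem_nonidentityCyclicPSubgroups.1 hC
    obtain ⟨n, hn⟩ := IsPGroup.iff_card.1 hC
    have hn0 : n ≠ 0 := by
      rintro rfl
      exact hb (Subgroup.card_eq_one.1 (by simpa using hn))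
    have hcard : (Finset.univ.filter fun c : C => orderOf c = Nat.card C).card =
        (Nat.card C).totient := by
      have := IsCyclic.card_orderOf_eq_totient (α := C) (d := Nat.card C) (by simp)
      convert this
    -- The fibre over `C` consists of its generators, of which there are `φ(p ^ n) = (p - 1) / p * p
    -- ^ n`; this needs `n ≠ 0`.
    have he : ((Finset.univ.filter fun x : G => x ≠ 1 ∧ IsPGroup p (Subgroup.zpowers x)).filter
        fun x => Subgroup.zpowers x = C) =
        (Finset.univ.filter fun c : C => orderOf c = Nat.card C).map
          (Function.Embedding.subtype _) := by
      ext x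
      simp only [Finset.mem_filter, Finset.mem_univ, true_and, Finset.mem_map,
        Function.Embedding.coe_subtype, Subtype.exists, Subgroup.orderOf_mk, exists_and_right,
        exists_eq_right]
      constructor
      · rintro ⟨-, rfl⟩
        exact ⟨Subgroup.mem_zpowers x, (Nat.card_zpowers x).symm⟩
      · rintro ⟨hx, ho⟩
        have hz : Subgroup.zpowers x = C :=
          Subgroup.eq_of_le_of_card_ge (Subgroup.zpowers_le.2 hx) (by rw [Nat.card_zpowers, ho])
        refine ⟨⟨?_, hz ▸ hC⟩, hz⟩
        rintro rfl
        exact hb (by rw [← hz, Subgroup.zpowers_one_eq_bot])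
    rw [he, Finset.card_map, hcard, hn, Nat.totient_prime_pow hp.out (Nat.pos_of_ne_zero hn0)]
    obtain ⟨m, rfl⟩ := Nat.exists_eq_succ_of_ne_zero hn0
    have : (p : ℚ) ≠ 0 := Nat.cast_ne_zero.2 hp.out.ne_zero
    rw [Nat.cast_mul, Nat.cast_sub hp.out.one_le]
    push_cast
    rw [Nat.succ_eq_add_one]
    field_simp
    ring
  · intro x hx
    simp only [Finset.coe_filter, Finset.mem_univ, true_and, Set.mem_ofPred_eq] at hx
    exact mem_nonidentityCyclicPSubgroups.2
      ⟨hx.2, Subgroup.zpowers_ne_bot.2 hx.1, inferInstance⟩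

/-- Double counting of pairs `1 ≠ x ∈ H`: for fixed `x`, the weights of all `H ≥ ⟨x⟩` add up to `1`.
-/
theorem sum_one_sub_posetEulerChar_mul_card_sub_one {G : Type*} [Group G] [Fintype G] {p : ℕ}
    [Fact p.Prime] :
    ∑ H ∈ nonidentityPSubgroups p G,
      (1 - posetEulerChar (NonidentityPSubgroup p (NormalizerQuotient H))) *
        ((Nat.card H : ℚ) - 1) =
      (Finset.univ.filter fun x : G => x ≠ 1 ∧ IsPGroup p (Subgroup.zpowers x)).card := by
  have hcard (H : Subgroup G) :
      (Nat.card H : ℚ) - 1 = ((Finset.univ.filter fun x : G => x ≠ 1 ∧ x ∈ H).card : ℚ) := by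
    have h1 : (Finset.univ.filter fun x : G => x ∈ H) =
        insert 1 (Finset.univ.filter fun x : G => x ≠ 1 ∧ x ∈ H) := by
      ext x
      by_cases hx : x = 1 <;> simp [hx, H.one_mem]
    rw [show Nat.card H = (Finset.univ.filter fun x : G => x ∈ H).card by
      rw [Nat.card_eq_fintype_card]; exact Fintype.card_subtype _, h1,
      Finset.card_insert_of_notMem (by simp)]
    push_cast
    ring
  simp only [hcard, ← nsmul_eq_mul', ← Finset.sum_const]
  rw [Finset.sum_comm' (t' := Finset.univ.filter fun x : G => x ≠ 1 ∧
    IsPGroup p (Subgroup.zpowers x))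
    (s' := fun x => (nonidentityPSubgroups p G).filter (Subgroup.zpowers x ≤ ·))]
  · rw [Finset.cast_card]
    refine Finset.sum_congr rfl fun x hx => ?_
    simp only [Finset.mem_filter, Finset.mem_univ, true_and] at hx
    exact sum_one_sub_posetEulerChar_of_le hx.2 (Subgroup.zpowers_ne_bot.2 hx.1)
  · intro H x
    simp only [Finset.mem_filter, Finset.mem_univ, true_and, mem_nonidentityPSubgroups,
      Subgroup.zpowers_le]
    refine ⟨fun ⟨hH, hx, hxH⟩ => ⟨⟨hH, hxH⟩, hx, hH.1.to_le (Subgroup.zpowers_le.2 hxH)⟩,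
      fun ⟨⟨hH, hxH⟩, hx, _⟩ => ⟨hH, hx, hxH⟩⟩

theorem corollary1p2 {G : Type*} [Group G] [Fintype G] (p : ℕ) (hp : p.Prime) :
    (∑ H ∈ nonidentityPSubgroups p G,
      (1 - posetEulerChar (NonidentityPSubgroup p (NormalizerQuotient H)) + (subgroupMu H : ℚ))
        = 0) ∧
    (∑ H ∈ nonidentityPSubgroups p G,
      ∑ x : G with x ∈ Subgroup.centralizer (H : Set G),
        (1 - posetEulerChar (NonidentityPSubgroup p (CentralizerQuotient H x))
          + (subgroupMu H : ℚ)) = 0) ∧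
    (∑ H ∈ nonidentityPSubgroups p G,
      ∑ x : G with x ∈ Subgroup.centralizer (H : Set G),
        (1 - posetEulerChar (CentralizerPoset p H x) + (subgroupMu H : ℚ)) = 0) ∧
    (∑ H ∈ nonidentityPSubgroups p G,
      ((Nat.card H : ℚ)
          - posetEulerChar (NonidentityPSubgroup p (NormalizerQuotient H)) * (Nat.card H : ℚ)
          + (subgroupMu H : ℚ))
        = ((p : ℚ) - 1) / (p : ℚ)
          * ∑ C ∈ nonidentityCyclicPSubgroups p G, (Nat.card C : ℚ)) := by
  have := Fact.mk hp
  refine ⟨sum_one_sub_posetEulerChar_add_subgroupMu, ?_, ?_, ?_⟩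
  · rw [← sum_sum_centralizer_add_subgroupMu (p := p) (G := G)]
    refine Finset.sum_congr rfl fun H hH => Finset.sum_congr rfl fun x hx => ?_
    rw [(quotientPSubgroupOrderIso (mem_nonidentityPSubgroups.1 hH).1
      (le_inf Subgroup.le_normalizer fun h hh => Subgroup.mem_centralizer_singleton_iff.2
        (Subgroup.mem_centralizer_iff.1 (Finset.mem_filter.1 hx).2 h hh))).posetEulerChar_eq]
  · rw [← sum_sum_centralizer_add_subgroupMu (p := p) (G := G)]
    refine Finset.sum_congr rfl fun H hH => Finset.sum_congr rfl fun x _ => ?_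
    rw [(centralizerPosetOrderIso x (mem_nonidentityPSubgroups.1 hH).1).posetEulerChar_eq]
  -- Termwise, `|H| - χ|H| + μ = (1 - χ)(|H| - 1) + (1 - χ + μ)`.
  · rw [← card_nonidentity_pElements, ← sum_one_sub_posetEulerChar_mul_card_sub_one,
      ← sub_eq_zero, ← Finset.sum_sub_distrib,
      ← sum_one_sub_posetEulerChar_add_subgroupMu (p := p) (G := G)]
    refine Finset.sum_congr rfl fun H _ => ?_
    ring
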